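/- Let $q$ be a complex number with $0<|q|<1$. Put $(x;q)_\infty=\prod_{i\ge 0}(1-xq^i)$, $(x;q)_n=\prod_{i=0}^{n-1}(1-xq^i)$ and $(x_1,\dots,x_r;q)_n=(x_1;q)_n\cdots(x_r;q)_n$ (likewise for $n=\infty$), and let $$\theta(q,x)=\sum_{n=0}^{\infty}(-1)^nq^{\binom n2}x^n,\qquad P_4(a,b)=(q,a,b;q)_\infty\sum_{n=0}^\infty\frac{(ab/q^4;q)_{2n}}{(q,a,b,ab/q^4;q)_n}\,q^n,$$ $$T(a)=\frac{a-a^2+aq-q^2}{1+q+q^2}\,\theta(q,a)+\frac{aq-a^2+aq^2-q^4}{aq}\,\theta(q,a/q).$$ Then for every complex number $a\neq 0$ such that no denominator in the series for $P_4(a,-a)$ vanishes (that is, $aq^i\ne 1$, $-aq^i\neq 1$ and $-a^2q^{i-4}\ne 1$ for all integers $i\ge 0$), this series converges and $$T(a)+T(-a)=\frac{2(1+q)^2(1+q^2)}{1+q+q^2}\,P_4(a,-a).$$ At the remaining values $a\ne0$ the identity holds with $P_4(a,-a)$ replaced by its continuous extension $\lim_{x\to a,\,x\ne a}P_4(x,-x)$.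 -/

import Mathlib

open Filter Topology

noncomputable section

namespace PartialTheta

/-- The infinite `q`-shifted factorial `(x;q)_∞ = ∏_{i ≥ 0} (1 - x q^i)`. -/
def qPochInf (x q : ℂ) : ℂ := ∏' i : ℕ, (1 - x * q ^ i)

/-- The finite `q`-shifted factorial `(x;q)_n = ∏_{0 ≤ i < n} (1 - x q^i)`.
It equals `(x;q)_∞ / (x q^n;q)_∞`, see `qPoch_eq_div`. -/
def qPoch (x q : ℂ) (n : ℕ) : ℂ := ∏ i ∈ Finset.range n, (1 - x * q ^ i)

/-- The partial theta function `θ(q,x) = ∑_{n ≥ 0} (-1)^n q^{n(n-1)/2} x^n`. -/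
def theta (q x : ℂ) : ℂ := ∑' n : ℕ, (-1) ^ n * q ^ (n.choose 2) * x ^ n

/-- The `n`-th term of the series in `P_m(a,b)`:
`(ab/q^m;q)_{2n} / (q,a,b,ab/q^m;q)_n * q^n`. -/
def PTerm (m : ℕ) (q a b : ℂ) (n : ℕ) : ℂ :=
  qPoch (a * b / q ^ m) q (2 * n) /
    (qPoch q q n * qPoch a q n * qPoch b q n * qPoch (a * b / q ^ m) q n) * q ^ n

/-- `P_m(a,b) = (q,a,b;q)_∞ ∑_{n ≥ 0} (ab/q^m;q)_{2n} / (q,a,b,ab/q^m;q)_n * q^n`. -/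
def P (m : ℕ) (q a b : ℂ) : ℂ :=
  qPochInf q q * qPochInf a q * qPochInf b q * ∑' n : ℕ, PTerm m q a b n

/-- The combination `T(a)` of `θ(q,a)` and `θ(q,a/q)`. -/
def T (q a : ℂ) : ℂ :=
  (a - a ^ 2 + a * q - q ^ 2) / (1 + q + q ^ 2) * theta q a +
    (a * q - a ^ 2 + a * q ^ 2 - q ^ 4) / (a * q) * theta q (a / q)

/-- The infinite product defining `(x;q)_∞` converges for `|q| < 1`. -/
theorem multipliable_qPochInf {q : ℂ} (hq : ‖q‖ < 1) (x : ℂ) :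
    Multipliable fun i : ℕ => 1 - x * q ^ i := by
  have h : Summable fun i : ℕ => ‖-(x * q ^ i)‖ := by
    simpa [norm_mul, norm_pow] using
      (summable_geometric_of_lt_one (norm_nonneg q) hq).mul_left ‖x‖
  simpa [sub_eq_add_neg] using multipliable_one_add_of_summable h

/-- `(x;q)_n = (x;q)_∞ / (x q^n;q)_∞` whenever the denominator does not vanish. -/
theorem qPoch_eq_div {q : ℂ} (hq : ‖q‖ < 1) (x : ℂ) (n : ℕ)
    (h : qPochInf (x * q ^ n) q ≠ 0) :
    qPoch x q n = qPochInf x q / qPochInf (x * q ^ n) q := by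
  rw [eq_div_iff h]
  have hm : Multipliable fun i : ℕ => 1 - x * q ^ (i + n) := by
    have := multipliable_qPochInf hq (x * q ^ n)
    refine this.congr fun i => ?_
    ring
  have key := Multipliable.prod_mul_tprod_nat_mul' (f := fun i : ℕ => 1 - x * q ^ i) hm
  unfold qPoch qPochInf
  rw [← key]
  congr 1
  refine tprod_congr fun i => ?_
  ring

/-- The series defining `θ(q,x)` converges for `|q| < 1`. -/
theorem summable_theta {q : ℂ} (hq : ‖q‖ < 1) (x : ℂ) :
    Summable fun n : ℕ => (-1) ^ n * q ^ (n.choose 2) * x ^ n := by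
  have hlim : Tendsto (fun n : ℕ => ‖q‖ ^ n * ‖x‖) atTop (𝓝 0) := by
    simpa using (tendsto_pow_atTop_nhds_zero_of_lt_one (norm_nonneg q) hq).mul_const ‖x‖
  have hev : ∀ᶠ n : ℕ in atTop, ‖q‖ ^ n * ‖x‖ ≤ 1 / 2 :=
    hlim.eventually (ge_mem_nhds (by norm_num))
  refine summable_of_ratio_norm_eventually_le (r := 1 / 2) (by norm_num) ?_
  filter_upwards [hev] with n hn
  have e : (n + 1).choose 2 = n + n.choose 2 := by
    rw [Nat.choose_succ_succ' n 1, Nat.choose_one_right]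
  simp only [norm_mul, norm_pow, norm_neg, norm_one, one_pow, one_mul, e]
  calc ‖q‖ ^ (n + n.choose 2) * ‖x‖ ^ (n + 1)
      = (‖q‖ ^ n * ‖x‖) * (‖q‖ ^ (n.choose 2) * ‖x‖ ^ n) := by ring
    _ ≤ 1 / 2 * (‖q‖ ^ (n.choose 2) * ‖x‖ ^ n) := by gcongr

end PartialTheta

end

noncomputable section

namespace PartialTheta

/-! With y = a²/q⁴, moving the infinite products into the series for P_4(a,-a) turns it into a
series in y without denominators (`entireTerm`), convergent for every y. Expanding the factors by
the q-binomial theorem and Euler's identities gives an absolutely convergent triple sum over l, j,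
k. Summing over l instead, and then collecting j + k = N, leaves a power series in y whose N-th
coefficient is a power of q times the terminating ₂φ₁ `phi q N` at q³ (`hasSum_entireTerm`,
`hasSum_phi`).

This value is explicit: `phi q N q` is a power of q (`phi_self`), and the q-difference equation
carries it to q² and q³ (`phi_pow_three`). The series thus becomes a combination of `evenTheta` at
y, q²y and q⁴y (`tsum_entireTerm`). On the other side, T(a) + T(-a) reduces to the same combination
by splitting θ into even and odd parts and using `evenTheta_eq`.

Since T is continuous away from 0 and the excluded points are isolated, the limit statement follows
from the identity at the other points. -/

/-! ### Elementary properties of q-shifted factorials. -/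

theorem qPoch_zero (x q : ℂ) : qPoch x q 0 = 1 := by simp [qPoch]

theorem qPoch_succ (x q : ℂ) (n : ℕ) : qPoch x q (n + 1) = qPoch x q n * (1 - x * q ^ n) := by
  simp [qPoch, Finset.prod_range_succ]

theorem qPoch_add (x q : ℂ) (m n : ℕ) :
    qPoch x q (m + n) = qPoch x q m * qPoch (x * q ^ m) q n := by
  simp only [qPoch, Finset.prod_range_add, pow_add, mul_assoc]

theorem qPoch_mul_qPochInf {q : ℂ} (hq : ‖q‖ < 1) (x : ℂ) (n : ℕ) :
    qPoch x q n * qPochInf (x * q ^ n) q = qPochInf x q := by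
  have hm : Multipliable fun i : ℕ => 1 - x * q ^ (i + n) :=
    (multipliable_qPochInf hq (x * q ^ n)).congr fun i => by ring
  unfold qPoch qPochInf
  rw [← Multipliable.prod_mul_tprod_nat_mul' (f := fun i : ℕ => 1 - x * q ^ i) hm]
  congr 1
  exact tprod_congr fun i => by ring

theorem qPochInf_mul_neg {q : ℂ} (hq : ‖q‖ < 1) (x : ℂ) :
    qPochInf x q * qPochInf (-x) q = qPochInf (x ^ 2) (q ^ 2) := by
  unfold qPochInf
  rw [← (multipliable_qPochInf hq x).tprod_mul (multipliable_qPochInf hq (-x))]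
  exact tprod_congr fun i => by ring

theorem tendsto_qPoch {q : ℂ} (hq : ‖q‖ < 1) (x : ℂ) :
    Tendsto (qPoch x q) atTop (𝓝 (qPochInf x q)) :=
  (multipliable_qPochInf hq x).hasProd.tendsto_prod_nat

theorem qPochInf_ne_zero {q : ℂ} (hq : ‖q‖ < 1) {x : ℂ} (hx : ∀ i : ℕ, 1 - x * q ^ i ≠ 0) :
    qPochInf x q ≠ 0 := by
  have h : Summable fun i : ℕ => ‖-(x * q ^ i)‖ := by
    simpa [norm_mul, norm_pow] using
      (summable_geometric_of_lt_one (norm_nonneg q) hq).mul_left ‖x‖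
  simpa [qPochInf, sub_eq_add_neg] using
    tprod_one_add_ne_zero_of_summable (f := fun i : ℕ => -(x * q ^ i))
      (fun i => by simpa [sub_eq_add_neg] using hx i) h

theorem one_sub_ne_zero_of_norm_lt {w : ℂ} (hw : ‖w‖ < 1) : 1 - w ≠ 0 := by
  intro h
  rw [sub_eq_zero] at h
  simp [← h] at hw

theorem one_sub_pow_ne_zero {q : ℂ} (hq : ‖q‖ < 1) {n : ℕ} (hn : n ≠ 0) : 1 - q ^ n ≠ 0 :=
  one_sub_ne_zero_of_norm_lt (by rw [norm_pow]; exact pow_lt_one₀ (norm_nonneg q) hq hn)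

theorem one_sub_self_mul_pow_ne_zero {q : ℂ} (hq : ‖q‖ < 1) (i : ℕ) : 1 - q * q ^ i ≠ 0 := by
  rw [← pow_succ']
  exact one_sub_pow_ne_zero hq i.succ_ne_zero

theorem qPoch_self_ne_zero {q : ℂ} (hq : ‖q‖ < 1) (n : ℕ) : qPoch q q n ≠ 0 :=
  Finset.prod_ne_zero_iff.2 fun i _ => one_sub_self_mul_pow_ne_zero hq i

theorem exists_norm_inv_qPoch_self_le {q : ℂ} (hq : ‖q‖ < 1) :
    ∃ C : ℝ, 0 < C ∧ ∀ n, ‖(qPoch q q n)⁻¹‖ ≤ C := by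
  have h := (tendsto_qPoch hq q).inv₀ (qPochInf_ne_zero hq (one_sub_self_mul_pow_ne_zero hq))
  obtain ⟨C, hC⟩ := h.norm.bddAbove_range
  exact ⟨max C 1, by positivity, fun n => (hC ⟨n, rfl⟩).trans (le_max_left _ _)⟩

/-! ### Euler's expansions and the q-binomial theorem. -/

/-- A power series with constant term `1` that is absolutely convergent at `x` tends to `1`
along `x q^n`. -/
theorem tendsto_tsum_mul_pow {q : ℂ} (hq : ‖q‖ < 1) {c : ℕ → ℂ} (hc : c 0 = 1) {x : ℂ}
    (h : Summable fun k => c k * x ^ k) :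
    Tendsto (fun n : ℕ => ∑' k, c k * (x * q ^ n) ^ k) atTop (𝓝 1) := by
  have key : ∑' k, c k * (if k = 0 then 1 else 0) = 1 := by
    rw [tsum_eq_single 0 (by intro b hb; simp [hb])]
    simp [hc]
  rw [← key]
  refine tendsto_tsum_of_dominated_convergence h.norm (fun k => ?_) (.of_forall fun n k => ?_)
  · refine Tendsto.const_mul _ ?_
    rcases eq_or_ne k 0 with rfl | hk
    · simp
    · have := ((tendsto_pow_atTop_nhds_zero_of_norm_lt_one hq).const_mul x).pow k
      simpa [hk] using this
  · rw [mul_pow, norm_mul, norm_mul, norm_mul, norm_pow (q ^ n), norm_pow q]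
    have h1 : (‖q‖ ^ n) ^ k ≤ 1 := pow_le_one₀ (by positivity) (pow_le_one₀ (by positivity) hq.le)
    have : 0 ≤ ‖c k‖ * ‖x ^ k‖ := by positivity
    nlinarith

theorem summable_pow_div_qPoch {q : ℂ} (hq : ‖q‖ < 1) {x : ℂ} (hx : ‖x‖ < 1) :
    Summable fun k : ℕ => (qPoch q q k)⁻¹ * x ^ k := by
  obtain ⟨C, -, hC⟩ := exists_norm_inv_qPoch_self_le hq
  refine .of_norm_bounded ((summable_geometric_of_lt_one (norm_nonneg x) hx).mul_left C) fun k => ?_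
  rw [norm_mul, norm_pow]
  gcongr
  exact hC k

theorem summable_euler {q : ℂ} (hq : ‖q‖ < 1) (x : ℂ) :
    Summable fun k : ℕ => (-1) ^ k * q ^ (k.choose 2) / qPoch q q k * x ^ k := by
  obtain ⟨C, -, hC⟩ := exists_norm_inv_qPoch_self_le hq
  refine .of_norm_bounded ((summable_theta hq x).norm.mul_left C) fun k => ?_
  rw [div_eq_mul_inv, mul_right_comm, norm_mul, mul_comm]
  gcongr
  exact hC k

/-- Euler's expansion of `1 / (x;q)_∞`. -/
theorem tsum_pow_div_qPoch_mul {q : ℂ} (hq : ‖q‖ < 1) {x : ℂ} (hx : ‖x‖ < 1) :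
    (∑' k : ℕ, (qPoch q q k)⁻¹ * x ^ k) * qPochInf x q = 1 := by
  set e : ℂ → ℂ := fun x => ∑' k : ℕ, (qPoch q q k)⁻¹ * x ^ k with he
  -- Comparing coefficients gives a first-order q-difference equation. Iterating it and letting x
  -- q^n → 0 identifies the sum.
  have step : ∀ x : ℂ, ‖x‖ < 1 → e x * (1 - x) = e (x * q) := by
    intro x hx
    have hxq : ‖x * q‖ < 1 := by
      rw [norm_mul]; nlinarith [norm_nonneg x, norm_nonneg q]
    have h1 := summable_pow_div_qPoch hq hx
    have h2 := summable_pow_div_qPoch hq hxq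
    have : e x - e (x * q) = x * e x := by
      simp only [he]
      rw [← h1.tsum_sub h2, (h1.sub h2).tsum_eq_zero_add, ← tsum_mul_left]
      simp only [pow_zero, sub_self, zero_add]
      refine tsum_congr fun k => ?_
      have := qPoch_self_ne_zero hq k
      have h3 := one_sub_self_mul_pow_ne_zero hq k
      rw [qPoch_succ]
      field_simp
      ring
    linear_combination this
  have iter : ∀ n : ℕ, e x * qPoch x q n = e (x * q ^ n) := by
    intro n
    induction n with
    | zero => simp [qPoch_zero]
    | succ n ih =>
      have hxq : ‖x * q ^ n‖ < 1 := by
        rw [norm_mul, norm_pow]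
        have := pow_le_one₀ (n := n) (norm_nonneg q) hq.le
        nlinarith [norm_nonneg x]
      rw [qPoch_succ, ← mul_assoc, ih, step _ hxq, pow_succ, mul_assoc]
  have l1 := (tendsto_qPoch hq x).const_mul (e x)
  have l2 := tendsto_tsum_mul_pow hq (c := fun k => (qPoch q q k)⁻¹) (by simp [qPoch_zero])
    (summable_pow_div_qPoch hq hx)
  exact tendsto_nhds_unique l1 (l2.congr fun n => (iter n).symm)

/-- Euler's expansion of `(x;q)_∞`. -/
theorem hasSum_euler {q : ℂ} (hq : ‖q‖ < 1) (x : ℂ) :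
    HasSum (fun k : ℕ => (-1) ^ k * q ^ (k.choose 2) / qPoch q q k * x ^ k) (qPochInf x q) := by
  set c : ℕ → ℂ := fun k => (-1) ^ k * q ^ (k.choose 2) / qPoch q q k with hc
  set e : ℂ → ℂ := fun x => ∑' k : ℕ, c k * x ^ k with he
  have step : ∀ x : ℂ, e x = (1 - x) * e (x * q) := by
    intro x
    have h1 := summable_euler hq x
    have h2 := summable_euler hq (x * q)
    have : e x - e (x * q) = -x * e (x * q) := by
      simp only [he]
      rw [← h1.tsum_sub h2, (h1.sub h2).tsum_eq_zero_add, ← tsum_mul_left]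
      simp only [pow_zero, sub_self, zero_add]
      refine tsum_congr fun k => ?_
      have := qPoch_self_ne_zero hq k
      have h3 := one_sub_self_mul_pow_ne_zero hq k
      have e2 : (k + 1).choose 2 = k + k.choose 2 := by
        rw [Nat.choose_succ_succ' k 1, Nat.choose_one_right]
      simp only [hc]
      rw [qPoch_succ, e2]
      field_simp
      ring
    linear_combination this
  have iter : ∀ n : ℕ, e x = qPoch x q n * e (x * q ^ n) := by
    intro n
    induction n with
    | zero => simp [qPoch_zero]
    | succ n ih => rw [qPoch_succ, mul_assoc, pow_succ, ← mul_assoc x, ← step, ih]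
  have l1 := (tendsto_qPoch hq x).mul
    (tendsto_tsum_mul_pow hq (c := c) (by simp [hc, qPoch_zero]) (summable_euler hq x))
  rw [mul_one] at l1
  have : e x = qPochInf x q :=
    tendsto_nhds_unique tendsto_const_nhds (l1.congr fun n => (iter n).symm)
  exact this ▸ (summable_euler hq x).hasSum

/-- The `q`-binomial theorem, `(-x;q)_n = ∑_{l+j=n} (q;q)_n / ((q;q)_l (q;q)_j) q^{j(j-1)/2} x^j`. -/
theorem qPoch_neg_eq_sum {q : ℂ} (hq : ‖q‖ < 1) (x : ℂ) (n : ℕ) :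
    qPoch (-x) q n = qPoch q q n * ∑ p ∈ Finset.HasAntidiagonal.antidiagonal n,
      q ^ (p.2.choose 2) * x ^ p.2 / (qPoch q q p.1 * qPoch q q p.2) := by
  induction n generalizing x with
  | zero => simp [qPoch_zero]
  | succ n ih =>
    have hn := qPoch_self_ne_zero hq n
    set f : ℕ × ℕ → ℂ := fun p => q ^ (p.2.choose 2) * x ^ p.2 / (qPoch q q p.1 * qPoch q q p.2)
      with hf
    -- For l + j = n + 1, the q-Pascal splitting 1 - q^(n+1) = (1 - q^l) + q^l (1 - q^j) is used;
    -- each part lowers one index by 1.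
    have h1 : ∑ p ∈ Finset.HasAntidiagonal.antidiagonal (n + 1), (1 - q ^ p.1) * f p =
        ∑ p ∈ Finset.HasAntidiagonal.antidiagonal n, f p := by
      rw [Finset.Nat.sum_antidiagonal_succ]
      simp only [pow_zero, sub_self, zero_mul, zero_add]
      refine Finset.sum_congr rfl fun p _ => ?_
      have := qPoch_self_ne_zero hq p.1
      have := qPoch_self_ne_zero hq p.2
      have := one_sub_self_mul_pow_ne_zero hq p.1
      simp only [hf, qPoch_succ]
      field_simp
      ring
    have h2 : ∑ p ∈ Finset.HasAntidiagonal.antidiagonal (n + 1), q ^ p.1 * (1 - q ^ p.2) * f p =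
        x * q ^ n * ∑ p ∈ Finset.HasAntidiagonal.antidiagonal n, f p := by
      rw [Finset.Nat.sum_antidiagonal_succ', Finset.mul_sum]
      simp only [pow_zero, sub_self, zero_mul, mul_zero, zero_add]
      refine Finset.sum_congr rfl fun p hp => ?_
      have := qPoch_self_ne_zero hq p.1
      have := qPoch_self_ne_zero hq p.2
      have := one_sub_self_mul_pow_ne_zero hq p.2
      have e2 : (p.2 + 1).choose 2 = p.2 + p.2.choose 2 := by
        rw [Nat.choose_succ_succ' p.2 1, Nat.choose_one_right]
      rw [← Finset.HasAntidiagonal.mem_antidiagonal.1 hp]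
      simp only [hf, qPoch_succ, e2]
      field_simp
      ring
    have h3 : (1 - q * q ^ n) * ∑ p ∈ Finset.HasAntidiagonal.antidiagonal (n + 1), f p =
        (1 + x * q ^ n) * ∑ p ∈ Finset.HasAntidiagonal.antidiagonal n, f p := by
      rw [add_mul, one_mul, ← h2, ← h1, ← Finset.sum_add_distrib, Finset.mul_sum]
      refine Finset.sum_congr rfl fun p hp => ?_
      rw [← pow_succ', ← Finset.HasAntidiagonal.mem_antidiagonal.1 hp]
      ring
    rw [qPoch_succ, qPoch_succ q, mul_assoc, h3, ih]
    ring

theorem hasSum_sum_antidiagonal {f : ℕ × ℕ → ℂ} {s : ℂ} (h : HasSum f s) :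
    HasSum (fun n => ∑ p ∈ Finset.HasAntidiagonal.antidiagonal n, f p) s := by
  have h1 := (Finset.HasAntidiagonal.sigmaAntidiagonalEquivProd (A := ℕ)).hasSum_iff.2 h
  exact h1.sigma fun n => (Finset.HasAntidiagonal.antidiagonal n).hasSum f

/-! ### Evaluation of the terminating ₂φ₁. -/

/-- The coefficients `(q^{-N}, q^{N+1};q)_k / (q^2;q^2)_k` of a terminating `₂φ₁`. -/
def phiCoeff (q : ℂ) (N k : ℕ) : ℂ :=
  qPoch (q ^ N)⁻¹ q k * qPoch (q ^ (N + 1)) q k / qPoch (q ^ 2) (q ^ 2) k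

/-- The terminating series `₂φ₁(q^{-N}, q^{N+1}; -q; q, x)`. -/
def phi (q : ℂ) (N : ℕ) (x : ℂ) : ℂ := ∑ k ∈ Finset.range (N + 1), phiCoeff q N k * x ^ k

theorem norm_sq_lt_one {q : ℂ} (hq : ‖q‖ < 1) : ‖q ^ 2‖ < 1 := by
  rw [norm_pow]; exact pow_lt_one₀ (norm_nonneg q) hq two_ne_zero

theorem phiCoeff_succ {q : ℂ} (hq : ‖q‖ < 1) (N k : ℕ) :
    phiCoeff q N (k + 1) * (1 - (q ^ 2) ^ (k + 1)) =
      phiCoeff q N k * ((1 - (q ^ N)⁻¹ * q ^ k) * (1 - q ^ (N + 1) * q ^ k)) := by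
  have h1 := qPoch_self_ne_zero (norm_sq_lt_one hq) k
  have h2 := one_sub_self_mul_pow_ne_zero (norm_sq_lt_one hq) k
  unfold phiCoeff
  rw [qPoch_succ, qPoch_succ, qPoch_succ, pow_succ' (q ^ 2)]
  field_simp

theorem qPoch_inv_pow_succ_self {q : ℂ} (hq0 : q ≠ 0) (N : ℕ) :
    qPoch (q ^ N)⁻¹ q (N + 1) = 0 := by
  rw [qPoch_succ, inv_mul_cancel₀ (pow_ne_zero N hq0), sub_self, mul_zero]

/-- The second order `q`-difference equation of `phi`. -/
theorem phi_sub_phi {q : ℂ} (hq0 : q ≠ 0) (hq : ‖q‖ < 1) (N : ℕ) (x : ℂ) :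
    phi q N x - phi q N (x * q ^ 2) =
      x * (phi q N x - ((q ^ N)⁻¹ + q ^ (N + 1)) * phi q N (x * q) + q * phi q N (x * q ^ 2)) := by
  -- The coefficient recurrence makes the partial sums telescope; the boundary term vanishes at K =
  -- N + 1, where the series has terminated.
  have tel : ∀ K : ℕ, ∑ k ∈ Finset.range K, phiCoeff q N k * x ^ k * ((1 - (q ^ 2) ^ k) -
      x * ((1 - (q ^ N)⁻¹ * q ^ k) * (1 - q ^ (N + 1) * q ^ k))) =
      -(x ^ K * (phiCoeff q N K * (1 - (q ^ 2) ^ K))) := by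
    intro K
    induction K with
    | zero => simp
    | succ K ih => rw [Finset.sum_range_succ, ih, phiCoeff_succ hq]; ring
  have h0 := tel (N + 1)
  rw [phiCoeff, qPoch_inv_pow_succ_self hq0, zero_mul, zero_div, zero_mul, mul_zero, neg_zero] at h0
  rw [← sub_eq_zero, ← h0]
  simp only [phi, Finset.mul_sum, ← Finset.sum_sub_distrib, ← Finset.sum_add_distrib]
  refine Finset.sum_congr rfl fun k _ => ?_
  have := pow_ne_zero N hq0
  field_simp
  ring

theorem phi_self {q : ℂ} (hq0 : q ≠ 0) (hq : ‖q‖ < 1) (N : ℕ) :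
    phi q N q = q ^ ((N + 1).choose 2) := by
  induction N with
  | zero => simp [phi, phiCoeff, qPoch_zero]
  | succ N ih =>
    have hN := pow_ne_zero (N + 1) hq0
    set v : ℕ → ℂ := fun k => qPoch (q ^ N)⁻¹ q k * qPoch (q ^ (N + 2)) q k /
      qPoch (q ^ 2) (q ^ 2) k with hv
    -- The induction rests on φ_{N+1}(q) = q^(N+1) φ_N(q). The partial sums of the difference have a
    -- closed form, which is zero at K = N + 1 because of the factor (q^{-N};q)_{N+1}.
    have tel : ∀ K : ℕ, ∑ k ∈ Finset.range (K + 1),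
        (phiCoeff q (N + 1) k - q ^ (N + 1) * phiCoeff q N k) * q ^ k =
        (1 - q ^ (N + 1)) * v K := by
      intro K
      induction K with
      | zero => simp [phiCoeff, hv, qPoch_zero]
      | succ K ihK =>
        rw [Finset.sum_range_succ, ihK]
        have h1 := qPoch_self_ne_zero (norm_sq_lt_one hq) K
        have h2 := one_sub_self_mul_pow_ne_zero (norm_sq_lt_one hq) K
        have s1 : qPoch (q ^ (N + 1))⁻¹ q (K + 1) =
            (1 - (q ^ (N + 1))⁻¹) * qPoch (q ^ N)⁻¹ q K := by
          rw [add_comm K, qPoch_add, pow_one, qPoch_succ, qPoch_zero]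
          have : (q ^ (N + 1))⁻¹ * q = (q ^ N)⁻¹ := by rw [pow_succ]; field_simp
          rw [this]; ring
        have s2 : qPoch (q ^ (N + 1)) q (K + 1) =
            (1 - q ^ (N + 1)) * qPoch (q ^ (N + 2)) q K := by
          rw [add_comm K, qPoch_add, pow_one, qPoch_succ, qPoch_zero, ← pow_succ q (N + 1)]
          ring
        have s3 : (q ^ N)⁻¹ = (q ^ (N + 1))⁻¹ * q := by rw [pow_succ]; field_simp
        simp only [phiCoeff, hv]
        rw [s1, s2, show N + 1 + 1 = N + 2 from rfl, qPoch_succ (q ^ (N + 2)),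
          qPoch_succ (q ^ N)⁻¹, qPoch_succ (q ^ 2)]
        generalize qPoch (q ^ N)⁻¹ q K = A
        generalize qPoch (q ^ (N + 2)) q K = B
        rw [s3, show q ^ (N + 2) = q ^ (N + 1) * q from pow_succ q (N + 1)]
        generalize q ^ (N + 1) = u at *
        field_simp
        ring
    have h0 := tel (N + 1)
    rw [hv] at h0
    simp only [qPoch_inv_pow_succ_self hq0, zero_mul, zero_div, mul_zero, sub_mul,
      Finset.sum_sub_distrib] at h0
    rw [Finset.sum_range_succ (fun k => q ^ (N + 1) * phiCoeff q N k * q ^ k)] at h0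
    simp only [mul_assoc, ← Finset.mul_sum] at h0
    change phi q (N + 1) q - (q ^ (N + 1) * phi q N q + _) = 0 at h0
    rw [phiCoeff, qPoch_inv_pow_succ_self hq0, ih] at h0
    have e2 : (N + 1 + 1).choose 2 = (N + 1) + (N + 1).choose 2 := by
      rw [Nat.choose_succ_succ' (N + 1) 1, Nat.choose_one_right]
    rw [e2, pow_add]
    linear_combination h0

/-- At x = 1 the terms φ(1) cancel from the q-difference equation, so φ(q²) is determined by φ(q);
then x = q determines φ(q³). -/
theorem phi_pow_three {q : ℂ} (hq0 : q ≠ 0) (hq : ‖q‖ < 1) (N : ℕ) :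
    (1 + q) * (1 + q ^ 2) * phi q N (q ^ 3) =
      (1 - q ^ 2 + q * ((q ^ N)⁻¹ + q ^ (N + 1)) ^ 2) * q ^ ((N + 1).choose 2) := by
  have h1 := phi_sub_phi hq0 hq N 1
  have h2 := phi_sub_phi hq0 hq N q
  rw [← phi_self hq0 hq]
  simp only [one_mul] at h1
  rw [show q * q ^ 2 = q ^ 3 by ring, ← sq] at h2
  generalize ((q ^ N)⁻¹ + q ^ (N + 1)) = Q at *
  linear_combination -(1 + q) * h2 - q * Q * h1

/-- `(q;q)_{j+2k}/(q;q)_j` in terms of the numerator of `phiCoeff`. -/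
theorem qPoch_self_add_two_mul {q : ℂ} (hq0 : q ≠ 0) (j k : ℕ) :
    qPoch q q (j + 2 * k) * q ^ (k.choose 2) = (-1) ^ k * qPoch q q j * q ^ ((j + k) * k) *
      (qPoch (q ^ (j + k))⁻¹ q k * qPoch (q ^ (j + k + 1)) q k) := by
  have key : qPoch q q (j + k) * q ^ (k.choose 2) =
      (-1) ^ k * qPoch q q j * q ^ ((j + k) * k) * qPoch (q ^ (j + k))⁻¹ q k := by
    induction k generalizing j with
    | zero => simp [qPoch_zero]
    | succ k ih =>
      have h := ih (j + 1)
      have e2 : (k + 1).choose 2 = k + k.choose 2 := by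
        rw [Nat.choose_succ_succ' k 1, Nat.choose_one_right]
      have := pow_ne_zero (j + 1 + k) hq0
      rw [show j + (k + 1) = j + 1 + k by ring, qPoch_succ _ _ k, e2, pow_add, mul_left_comm, h,
        qPoch_succ]
      field_simp
      ring
  rw [show j + 2 * k = j + k + k by ring, qPoch_add, mul_right_comm, key,
    show q * q ^ (j + k) = q ^ (j + k + 1) by ring]
  ring

/-! ### The triple series and its two orders of summation. -/

/-- The terms of the triple series obtained by expanding all the factors of `entireTerm`. -/
def tripleTerm (q y : ℂ) (p : (ℕ × ℕ) × ℕ) : ℂ :=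
  qPochInf q q * ((qPoch q q p.1.1)⁻¹ * (q ^ (1 + p.1.2 + 2 * p.2)) ^ p.1.1) *
    (q ^ (p.1.2.choose 2) * q ^ (p.1.2 * (1 + p.1.2 + 2 * p.2)) * y ^ p.1.2 *
      (qPoch q q p.1.2)⁻¹) *
    ((-1) ^ p.2 * (q ^ 2) ^ (p.2.choose 2) / qPoch (q ^ 2) (q ^ 2) p.2 * (q ^ 4 * y) ^ p.2)

/-- The `n`-th term of `P_4(a,-a)` for `a ^ 2 = q ^ 4 * y`, with the infinite products moved inside
the sum. -/
def entireTerm (q y : ℂ) (n : ℕ) : ℂ :=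
  q ^ n * qPochInf (q * q ^ n) q * qPoch (-(y * q ^ n)) q n *
    qPochInf (q ^ 4 * y * q ^ (2 * n)) (q ^ 2)

theorem summable_tripleTerm {q : ℂ} (hq : ‖q‖ < 1) (y : ℂ) : Summable (tripleTerm q y) := by
  obtain ⟨C, hC0, hC⟩ := exists_norm_inv_qPoch_self_le hq
  -- The majorant is a product of three single series: the mixed powers of q have nonnegative
  -- exponents, and 1 + j + 2k ≥ 1 leaves a geometric factor in l.
  have s1 : Summable fun l : ℕ => C * ‖q‖ ^ l :=
    (summable_geometric_of_lt_one (norm_nonneg q) hq).mul_left C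
  have s2 : Summable fun j : ℕ => ‖(-1) ^ j * q ^ (j.choose 2) * y ^ j‖ * C :=
    (summable_theta hq y).norm.mul_right C
  have s3 := (summable_euler (norm_sq_lt_one hq) (q ^ 4 * y)).norm
  have s12 := s1.mul_of_nonneg s2 (fun l => by positivity) (fun j => by positivity)
  have s := (s12.mul_of_nonneg s3 (fun l => by positivity) (fun j => by positivity)).mul_left
    ‖qPochInf q q‖
  refine .of_norm_bounded s fun p => ?_
  obtain ⟨⟨l, j⟩, k⟩ := p
  have e1 : ‖(q ^ (1 + j + 2 * k)) ^ l‖ ≤ ‖q‖ ^ l := by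
    rw [norm_pow, norm_pow]
    gcongr
    exact pow_le_of_le_one (norm_nonneg q) hq.le (by omega)
  have e2 : ‖q ^ (j * (1 + j + 2 * k))‖ ≤ 1 := by
    rw [norm_pow]; exact pow_le_one₀ (norm_nonneg q) hq.le
  have e3 : ‖(qPoch q q l)⁻¹ * (q ^ (1 + j + 2 * k)) ^ l‖ ≤ C * ‖q‖ ^ l := by
    rw [norm_mul]; gcongr; exact hC l
  have e4 : ‖q ^ (j.choose 2) * q ^ (j * (1 + j + 2 * k)) * y ^ j * (qPoch q q j)⁻¹‖ ≤
      ‖(-1) ^ j * q ^ (j.choose 2) * y ^ j‖ * C := by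
    rw [norm_mul]
    gcongr
    · rw [mul_right_comm, norm_mul, mul_assoc ((-1 : ℂ) ^ j), norm_mul ((-1 : ℂ) ^ j)]
      simp only [norm_pow (-1 : ℂ), norm_neg, norm_one, one_pow, one_mul]
      exact mul_le_of_le_one_right (norm_nonneg _) e2
    · exact hC j
  simp only [tripleTerm]
  rw [norm_mul, norm_mul, norm_mul, mul_assoc ‖qPochInf q q‖, mul_assoc ‖qPochInf q q‖]
  gcongr

theorem hasSum_tripleTerm_right {q : ℂ} (hq : ‖q‖ < 1) (y : ℂ) (p : ℕ × ℕ) :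
    HasSum (fun k => tripleTerm q y (p, k))
      (qPochInf q q * q ^ (p.1 + p.2) * qPochInf (q ^ 4 * y * q ^ (2 * (p.1 + p.2))) (q ^ 2) *
        (q ^ (p.2.choose 2) * (y * q ^ (p.1 + p.2)) ^ p.2 / (qPoch q q p.1 * qPoch q q p.2))) := by
  have h := (hasSum_euler (norm_sq_lt_one hq) (q ^ 4 * y * q ^ (2 * (p.1 + p.2)))).mul_left
    (qPochInf q q * q ^ (p.1 + p.2) *
      (q ^ (p.2.choose 2) * (y * q ^ (p.1 + p.2)) ^ p.2 / (qPoch q q p.1 * qPoch q q p.2)))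
  rw [mul_right_comm (qPochInf q q * q ^ (p.1 + p.2))] at h
  refine h.congr_fun fun k => ?_
  simp only [tripleTerm]
  ring

/-- Summing over k, then over l + j = n: the factor (q;q)_n of the q-binomial theorem turns
(q^{n+1};q)_∞ into (q;q)_∞. -/
theorem hasSum_entireTerm {q : ℂ} (hq : ‖q‖ < 1) (y : ℂ) :
    HasSum (entireTerm q y) (∑' p, tripleTerm q y p) := by
  have h := hasSum_sum_antidiagonal
    ((summable_tripleTerm hq y).hasSum.prod_fiberwise (hasSum_tripleTerm_right hq y))
  refine h.congr_fun fun n => ?_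
  rw [entireTerm, qPoch_neg_eq_sum hq, ← qPoch_mul_qPochInf hq q n]
  rw [← mul_assoc, Finset.mul_sum, Finset.sum_mul]
  refine Finset.sum_congr rfl fun p hp => ?_
  rw [Finset.HasAntidiagonal.mem_antidiagonal.1 hp]
  ring

/-- Euler's expansion gives 1/(q^{1+j+2k};q)_∞, which cuts (q;q)_∞ down to a finite product. -/
theorem hasSum_tripleTerm_left {q : ℂ} (hq : ‖q‖ < 1) (y : ℂ) (j k : ℕ) :
    HasSum (fun l => tripleTerm q y ((l, j), k))
      (qPoch q q (j + 2 * k) *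
    (q ^ (j.choose 2) * q ^ (j * (1 + j + 2 * k)) * y ^ j * (qPoch q q j)⁻¹) *
    ((-1) ^ k * (q ^ 2) ^ (k.choose 2) / qPoch (q ^ 2) (q ^ 2) k * (q ^ 4 * y) ^ k)) := by
  have hx : ‖q ^ (1 + j + 2 * k)‖ < 1 := by
    rw [norm_pow]; exact pow_lt_one₀ (norm_nonneg q) hq (by omega)
  have h1 := tsum_pow_div_qPoch_mul hq hx
  have h2 : qPoch q q (j + 2 * k) * qPochInf (q ^ (1 + j + 2 * k)) q = qPochInf q q := by
    rw [← qPoch_mul_qPochInf hq q (j + 2 * k), ← pow_succ', show 1 + j + 2 * k = j + 2 * k + 1 by ring]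
  have h := (((summable_pow_div_qPoch hq hx).hasSum.mul_left (qPochInf q q)).mul_right
    (q ^ (j.choose 2) * q ^ (j * (1 + j + 2 * k)) * y ^ j * (qPoch q q j)⁻¹)).mul_right
    ((-1) ^ k * (q ^ 2) ^ (k.choose 2) / qPoch (q ^ 2) (q ^ 2) k * (q ^ 4 * y) ^ k)
  have h3 : qPochInf q q * (∑' l : ℕ, (qPoch q q l)⁻¹ * (q ^ (1 + j + 2 * k)) ^ l) =
      qPoch q q (j + 2 * k) := by
    rw [← h2]; linear_combination qPoch q q (j + 2 * k) * h1
  rwa [h3] at h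

theorem two_mul_choose_two_add (n : ℕ) : 2 * n.choose 2 + n = n ^ 2 := by
  induction n with
  | zero => rfl
  | succ n ih =>
    rw [Nat.choose_succ_succ' n 1, Nat.choose_one_right]
    linarith

theorem sum_antidiagonal_eq_phi {q : ℂ} (hq0 : q ≠ 0) (hq : ‖q‖ < 1) (y : ℂ) (N : ℕ) :
    ∑ p ∈ Finset.HasAntidiagonal.antidiagonal N, (qPoch q q (p.1 + 2 * p.2) *
      (q ^ (p.1.choose 2) * q ^ (p.1 * (1 + p.1 + 2 * p.2)) * y ^ p.1 * (qPoch q q p.1)⁻¹) *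
      ((-1) ^ p.2 * (q ^ 2) ^ (p.2.choose 2) / qPoch (q ^ 2) (q ^ 2) p.2 * (q ^ 4 * y) ^ p.2)) =
    q ^ (N ^ 2 + N + N.choose 2) * y ^ N * phi q N (q ^ 3) := by
  rw [← Finset.Nat.sum_antidiagonal_swap, Finset.Nat.sum_antidiagonal_eq_sum_range_succ_mk, phi,
    Finset.mul_sum]
  refine Finset.sum_congr rfl fun k hk => ?_
  obtain ⟨j, rfl⟩ := Nat.exists_eq_add_of_le (Nat.lt_succ_iff.1 (Finset.mem_range.1 hk))
  simp only [Prod.swap, add_tsub_cancel_left, phiCoeff]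
  have h := qPoch_self_add_two_mul hq0 j k
  have hj := qPoch_self_ne_zero hq j
  have hk := qPoch_self_ne_zero (norm_sq_lt_one hq) k
  have hc : (k + j).choose 2 = k.choose 2 + j.choose 2 + j * k := by
    linarith [two_mul_choose_two_add k, two_mul_choose_two_add j, two_mul_choose_two_add (k + j)]
  have hq' := pow_ne_zero (k.choose 2) hq0
  have h' : qPoch q q (j + 2 * k) = (-1) ^ k * qPoch q q j * q ^ ((j + k) * k) *
      (qPoch (q ^ (j + k))⁻¹ q k * qPoch (q ^ (j + k + 1)) q k) / q ^ (k.choose 2) := by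
    rw [← h]; field_simp
  rw [h', hc, add_comm k j]
  generalize qPoch (q ^ (j + k))⁻¹ q k = A
  generalize qPoch (q ^ (j + k + 1)) q k = B
  rcases neg_one_pow_eq_or ℂ k with hs | hs <;> rw [hs] <;> field_simp <;> ring

theorem hasSum_phi {q : ℂ} (hq0 : q ≠ 0) (hq : ‖q‖ < 1) (y : ℂ) :
    HasSum (fun N => q ^ (N ^ 2 + N + N.choose 2) * y ^ N * phi q N (q ^ 3))
      (∑' p, tripleTerm q y p) := by
  -- The indices are rearranged from ((l, j), k) to ((j, k), l), so that l is summed first.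
  have h := (Equiv.prodAssoc ℕ ℕ ℕ).symm.hasSum_iff.2 (summable_tripleTerm hq y).hasSum
  have h' := (Equiv.prodComm (ℕ × ℕ) ℕ).hasSum_iff.2 h
  have h2 := hasSum_sum_antidiagonal
    (h'.prod_fiberwise (fun p => hasSum_tripleTerm_left hq y p.1 p.2))
  exact h2.congr_fun fun N => (sum_antidiagonal_eq_phi hq0 hq y N).symm

/-! ### Even partial theta series and the resulting identity. -/

/-- The series `∑ q^{N(2N-1)} z^N`, the even part of the partial theta function. -/
def evenTheta (q z : ℂ) : ℂ := ∑' N : ℕ, q ^ ((2 * N).choose 2) * z ^ N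

theorem summable_evenTheta {q : ℂ} (hq : ‖q‖ < 1) (z : ℂ) :
    Summable fun N : ℕ => q ^ ((2 * N).choose 2) * z ^ N := by
  obtain ⟨x, rfl⟩ := IsAlgClosed.exists_pow_nat_eq z two_pos
  have := (summable_theta hq x).comp_injective (mul_right_injective₀ (two_ne_zero (α := ℕ)))
  refine this.congr fun N => ?_
  simp [pow_mul]

theorem hasSum_evenTheta {q : ℂ} (hq : ‖q‖ < 1) (z : ℂ) :
    HasSum (fun N : ℕ => q ^ ((2 * N).choose 2) * z ^ N) (evenTheta q z) :=
  (summable_evenTheta hq z).hasSum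

theorem theta_eq_evenTheta {q : ℂ} (hq : ‖q‖ < 1) (x : ℂ) :
    theta q x = evenTheta q (x ^ 2) - x * evenTheta q (q ^ 2 * x ^ 2) := by
  have he := hasSum_evenTheta hq (x ^ 2)
  have ho := (hasSum_evenTheta hq (q ^ 2 * x ^ 2)).mul_left (-x)
  have e : HasSum (fun n : ℕ => (-1) ^ n * q ^ (n.choose 2) * x ^ n) _ :=
    HasSum.even_add_odd (he.congr_fun fun N => by simp [pow_mul]) (ho.congr_fun fun N => by
      have : (2 * N + 1).choose 2 = (2 * N).choose 2 + 2 * N := by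
        rw [Nat.choose_succ_succ' (2 * N) 1, Nat.choose_one_right, add_comm]
      rw [this]
      simp only [pow_succ, pow_mul, pow_add]
      ring)
  rw [theta, e.tsum_eq]
  ring

theorem evenTheta_eq {q : ℂ} (hq : ‖q‖ < 1) (z : ℂ) :
    evenTheta q z = 1 + q * z * evenTheta q (q ^ 4 * z) := by
  rw [evenTheta, (summable_evenTheta hq z).tsum_eq_zero_add, evenTheta, ← tsum_mul_left]
  simp only [mul_zero, Nat.choose_zero_succ, pow_zero, mul_one]
  congr 1
  refine tsum_congr fun N => ?_
  have : (2 * (N + 1)).choose 2 = (2 * N).choose 2 + 4 * N + 1 := by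
    linarith [two_mul_choose_two_add (2 * (N + 1)), two_mul_choose_two_add (2 * N)]
  rw [this]
  ring

/-- Expanding the square in `phi_pow_three` produces q^{-2N}, a constant and q^{2N+2}, one for each
of the three arguments of `evenTheta`. -/
theorem tsum_entireTerm {q : ℂ} (hq0 : q ≠ 0) (hq : ‖q‖ < 1) (y : ℂ) :
    (1 + q) * (1 + q ^ 2) * ∑' n, entireTerm q y n =
      (1 + q ^ 2) * evenTheta q (q ^ 2 * y) + q * evenTheta q y +
        q ^ 3 * evenTheta q (q ^ 4 * y) := by
  rw [(hasSum_entireTerm hq y).tsum_eq]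
  refine ((hasSum_phi hq0 hq y).mul_left ((1 + q) * (1 + q ^ 2))).unique ?_
  refine ((((hasSum_evenTheta hq (q ^ 2 * y)).mul_left (1 + q ^ 2)).add
    ((hasSum_evenTheta hq y).mul_left q)).add
    ((hasSum_evenTheta hq (q ^ 4 * y)).mul_left (q ^ 3))).congr_fun fun N => ?_
  have h := phi_pow_three hq0 hq N
  have hN := pow_ne_zero N hq0
  have hc : N ^ 2 + N + N.choose 2 + (N + 1).choose 2 = (2 * N).choose 2 + 2 * N := by
    linarith [two_mul_choose_two_add N, two_mul_choose_two_add (N + 1),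
      two_mul_choose_two_add (2 * N)]
  have e : (1 + q) * (1 + q ^ 2) * (q ^ (N ^ 2 + N + N.choose 2) * y ^ N * phi q N (q ^ 3)) =
      (1 - q ^ 2 + q * ((q ^ N)⁻¹ + q ^ (N + 1)) ^ 2) * y ^ N * q ^ ((2 * N).choose 2 + 2 * N) := by
    rw [← hc, pow_add q (N ^ 2 + N + N.choose 2)]
    linear_combination q ^ (N ^ 2 + N + N.choose 2) * y ^ N * h
  rw [e]
  field_simp
  ring

/-- Each finite factorial in the denominator shortens an infinite one, (a q^n, -a q^n; q)_∞ merges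
in base q², and the quotient of the factorials of -a²/q⁴ is the finite product in `entireTerm`. -/
theorem mul_PTerm_eq_entireTerm {q : ℂ} (hq0 : q ≠ 0) (hq : ‖q‖ < 1) {a : ℂ}
    (h1 : ∀ i : ℕ, 1 - a * q ^ i ≠ 0) (h2 : ∀ i : ℕ, 1 - -a * q ^ i ≠ 0)
    (h3 : ∀ i : ℕ, 1 - a * -a / q ^ 4 * q ^ i ≠ 0) (n : ℕ) :
    qPochInf q q * qPochInf a q * qPochInf (-a) q * PTerm 4 q a (-a) n =
      entireTerm q (a ^ 2 / q ^ 4) n := by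
  have n0 := qPoch_self_ne_zero hq n
  have n1 : qPoch a q n ≠ 0 := Finset.prod_ne_zero_iff.2 fun i _ => h1 i
  have n2 : qPoch (-a) q n ≠ 0 := Finset.prod_ne_zero_iff.2 fun i _ => h2 i
  have n3 : qPoch (a * -a / q ^ 4) q n ≠ 0 := Finset.prod_ne_zero_iff.2 fun i _ => h3 i
  have e1 : q ^ 4 * (a ^ 2 / q ^ 4) * q ^ (2 * n) = (a * q ^ n) ^ 2 := by field_simp; ring
  have e2 : -(a ^ 2 / q ^ 4 * q ^ n) = a * -a / q ^ 4 * q ^ n := by ring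
  rw [entireTerm, e1, ← qPochInf_mul_neg hq, e2, PTerm, two_mul, qPoch_add,
    ← qPoch_mul_qPochInf hq q n, ← qPoch_mul_qPochInf hq a n, ← qPoch_mul_qPochInf hq (-a) n,
    neg_mul]
  generalize qPoch (a * -a / q ^ 4) q n = c at *
  generalize qPoch (a * -a / q ^ 4 * q ^ n) q n = d
  field_simp

theorem T_add_T_neg {q : ℂ} (hq0 : q ≠ 0) (hq : ‖q‖ < 1) {a : ℂ} (ha : a ≠ 0) :
    T q a + T q (-a) = 2 * (1 + q) ^ 2 * (1 + q ^ 2) / (1 + q + q ^ 2) *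
      ∑' n, entireTerm q (a ^ 2 / q ^ 4) n := by
  have hd : 1 + q + q ^ 2 ≠ 0 := by
    intro h
    exact one_sub_pow_ne_zero hq three_ne_zero (by linear_combination (1 - q) * h)
  have hs := tsum_entireTerm hq0 hq (a ^ 2 / q ^ 4)
  have hA := evenTheta_eq hq (q ^ 2 * (a ^ 2 / q ^ 4))
  have hB := evenTheta_eq hq (a ^ 2 / q ^ 4)
  rw [show q ^ 4 * (q ^ 2 * (a ^ 2 / q ^ 4)) = q ^ 2 * a ^ 2 by field_simp] at hA
  rw [show q ^ 4 * (a ^ 2 / q ^ 4) = a ^ 2 by field_simp] at hB hs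
  have t1 := theta_eq_evenTheta hq a
  have t2 := theta_eq_evenTheta hq (-a)
  have t3 := theta_eq_evenTheta hq (a / q)
  have t4 := theta_eq_evenTheta hq (-a / q)
  rw [show q ^ 2 * (a / q) ^ 2 = a ^ 2 by field_simp,
    show (a / q) ^ 2 = q ^ 2 * (a ^ 2 / q ^ 4) by field_simp] at t3
  rw [show q ^ 2 * (-a / q) ^ 2 = a ^ 2 by field_simp,
    show (-a / q) ^ 2 = q ^ 2 * (a ^ 2 / q ^ 4) by field_simp] at t4
  rw [neg_sq] at t2
  rw [T, T, t1, t2, t3, t4]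
  have e : 2 * (1 + q) ^ 2 * (1 + q ^ 2) / (1 + q + q ^ 2) *
      ∑' n, entireTerm q (a ^ 2 / q ^ 4) n = 2 * (1 + q) / (1 + q + q ^ 2) *
      ((1 + q) * (1 + q ^ 2) * ∑' n, entireTerm q (a ^ 2 / q ^ 4) n) := by ring
  rw [e, hs]
  -- Eliminating A and B by the functional equation leaves a rational identity in a, q, D and G.
  generalize evenTheta q (q ^ 2 * (a ^ 2 / q ^ 4)) = A at *
  generalize evenTheta q (a ^ 2 / q ^ 4) = B at *
  generalize evenTheta q (a ^ 2) = D at *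
  generalize evenTheta q (q ^ 2 * a ^ 2) = G at *
  subst hB
  subst hA
  field_simp
  ring

/-! ### Continuity and the exceptional points. -/

theorem continuous_theta {q : ℂ} (hq : ‖q‖ < 1) : Continuous (theta q) := by
  rw [continuous_iff_continuousAt]
  intro x
  have h : ContinuousOn (theta q) (Metric.ball 0 (‖x‖ + 1)) := by
    refine continuousOn_tsum (u := fun n : ℕ => ‖q‖ ^ (n.choose 2) * (‖x‖ + 1) ^ n)
      (fun n => by fun_prop) ?_ fun n y hy => ?_
    · have := (summable_theta hq ((‖x‖ + 1 : ℝ) : ℂ)).norm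
      refine this.congr fun n => ?_
      simp [abs_of_nonneg (add_nonneg (norm_nonneg x) zero_le_one),
        -Complex.ofReal_add]
    · rw [mem_ball_zero_iff] at hy
      simp only [norm_mul, norm_pow, norm_neg, norm_one, one_pow, one_mul]
      gcongr
  exact h.continuousAt (Metric.isOpen_ball.mem_nhds (by simp))

theorem continuousAt_T {q : ℂ} (hq0 : q ≠ 0) (hq : ‖q‖ < 1) {a : ℂ} (ha : a ≠ 0) :
    ContinuousAt (T q) a := by
  have := continuous_theta hq
  unfold T
  have : a * q ≠ 0 := mul_ne_zero ha hq0
  fun_prop (disch := assumption)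

/-- The zeros of `∏ (1 - r(x) q^i)` are isolated when `r` takes each value finitely often. -/
theorem eventually_one_sub_mul_pow_ne_zero {q : ℂ} (hq : ‖q‖ < 1) {r : ℂ → ℂ}
    (hr : Continuous r) (hf : ∀ w, {x | r x = w}.Finite) (a : ℂ) :
    ∀ᶠ x in 𝓝[≠] a, ∀ i : ℕ, 1 - r x * q ^ i ≠ 0 := by
  -- Near a, the factors with i ≥ I cannot vanish, by size; each of the finitely many others
  -- vanishes at finitely many points.
  obtain ⟨I, hI⟩ : ∃ I : ℕ, ∀ i ≥ I, (‖r a‖ + 1) * ‖q‖ ^ i < 1 := by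
    have := (tendsto_pow_atTop_nhds_zero_of_lt_one (norm_nonneg q) hq).const_mul (‖r a‖ + 1)
    rw [mul_zero] at this
    exact eventually_atTop.1 (this.eventually_lt_const one_pos)
  have hb : ∀ᶠ x in 𝓝[≠] a, ‖r x‖ < ‖r a‖ + 1 :=
    (hr.norm.continuousAt.eventually_lt_const (lt_add_one _)).filter_mono nhdsWithin_le_nhds
  have hs : ∀ᶠ x in 𝓝[≠] a, ∀ i ∈ Finset.range I, 1 - r x * q ^ i ≠ 0 := by
    rw [Filter.eventually_all_finset]
    intro i _
    have hfin : {x | 1 - r x * q ^ i = 0}.Finite := by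
      refine (hf (q ^ i)⁻¹).subset fun x hx => ?_
      exact eq_inv_of_mul_eq_one_left (sub_eq_zero.1 hx).symm
    have h := (hfin.subset Set.sdiff_subset : ({x | 1 - r x * q ^ i = 0} \ {a}).Finite)
    filter_upwards [nhdsWithin_le_nhds (h.isClosed.isOpen_compl.mem_nhds (x := a) (by simp)),
      self_mem_nhdsWithin] with x hx hxa hx0
    exact hx ⟨hx0, hxa⟩
  filter_upwards [hb, hs] with x hx hxs i
  rcases lt_or_ge i I with hi | hi
  · exact hxs i (Finset.mem_range.2 hi)
  · refine one_sub_ne_zero_of_norm_lt ?_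
    rw [norm_mul, norm_pow]
    exact (mul_le_mul_of_nonneg_right hx.le (by positivity)).trans_lt (hI i hi)

theorem finite_sq_eq (w : ℂ) : {x : ℂ | x ^ 2 = w}.Finite := by
  obtain ⟨r, rfl⟩ := IsAlgClosed.exists_pow_nat_eq w two_pos
  exact (Set.toFinite {r, -r}).subset fun x hx => sq_eq_sq_iff_eq_or_eq_neg.1 hx

theorem summable_PTerm_and_T_add_T_neg {q : ℂ} (hq0 : q ≠ 0) (hq : ‖q‖ < 1) {a : ℂ} (ha : a ≠ 0)
    (h1 : ∀ i : ℕ, 1 - a * q ^ i ≠ 0) (h2 : ∀ i : ℕ, 1 - -a * q ^ i ≠ 0)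
    (h3 : ∀ i : ℕ, 1 - a * -a / q ^ 4 * q ^ i ≠ 0) :
    Summable (PTerm 4 q a (-a)) ∧
      T q a + T q (-a) = 2 * (1 + q) ^ 2 * (1 + q ^ 2) / (1 + q + q ^ 2) * P 4 q a (-a) := by
  have h := mul_PTerm_eq_entireTerm hq0 hq h1 h2 h3
  constructor
  -- The prefactor is nonzero, so summability passes from `entireTerm` to `PTerm`.
  · have h0 : qPochInf q q * qPochInf a q * qPochInf (-a) q ≠ 0 :=
      mul_ne_zero (mul_ne_zero (qPochInf_ne_zero hq (one_sub_self_mul_pow_ne_zero hq))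
        (qPochInf_ne_zero hq h1)) (qPochInf_ne_zero hq h2)
    rw [← summable_mul_left_iff h0]
    exact (hasSum_entireTerm hq _).summable.congr fun n => (h n).symm
  · rw [T_add_T_neg hq0 hq ha, P, ← tsum_congr h, tsum_mul_left]

end PartialTheta

end


theorem mainTheorem12 (q : ℂ) (hq0 : q ≠ 0) (hq1 : ‖q‖ < 1) (a : ℂ) (ha : a ≠ 0) :
    -- where no denominator of the series vanishes, it converges and the identity holds
    ((∀ i : ℕ, 1 - a * q ^ i ≠ 0) → (∀ i : ℕ, 1 - -a * q ^ i ≠ 0) →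
        (∀ i : ℕ, 1 - a * -a / q ^ 4 * q ^ i ≠ 0) →
      Summable (PartialTheta.PTerm 4 q a (-a)) ∧
      PartialTheta.T q a + PartialTheta.T q (-a) =
        2 * (1 + q) ^ 2 * (1 + q ^ 2) / (1 + q + q ^ 2) * PartialTheta.P 4 q a (-a)) ∧
    -- at every nonzero `a`, it holds with the right-hand side extended by continuity
    Tendsto (fun x : ℂ =>
        2 * (1 + q) ^ 2 * (1 + q ^ 2) / (1 + q + q ^ 2) * PartialTheta.P 4 q x (-x))
      (𝓝[≠] a) (𝓝 (PartialTheta.T q a + PartialTheta.T q (-a))) := by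
  open PartialTheta in
  refine ⟨summable_PTerm_and_T_add_T_neg hq0 hq1 ha, ?_⟩
  have hT : ContinuousAt (fun x => T q x + T q (-x)) a :=
    (continuousAt_T hq0 hq1 ha).add
      ((continuousAt_T hq0 hq1 (neg_ne_zero.2 ha)).comp (f := fun x : ℂ => -x) (by fun_prop))
  refine (hT.tendsto.mono_left nhdsWithin_le_nhds).congr' ?_
  have ne := (continuousAt_id.eventually_ne ha).filter_mono (nhdsWithin_le_nhds (s := {a}ᶜ))
  have e1 := eventually_one_sub_mul_pow_ne_zero hq1 (r := fun x => x) (by fun_prop)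
    (fun w => by simp) a
  have e2 := eventually_one_sub_mul_pow_ne_zero hq1 (r := fun x => -x) (by fun_prop)
    (fun w => by simp [neg_eq_iff_eq_neg]) a
  have e3 := eventually_one_sub_mul_pow_ne_zero hq1 (r := fun x => x * -x / q ^ 4) (by fun_prop)
    (fun w => (finite_sq_eq (-(w * q ^ 4))).subset fun x hx => by
      rw [Set.mem_ofPred_eq, div_eq_iff (pow_ne_zero 4 hq0)] at hx
      rw [Set.mem_ofPred_eq]
      linear_combination -hx) a
  filter_upwards [ne, e1, e2, e3] with x hx h1 h2 h3
  exact (summable_PTerm_and_T_add_T_neg hq0 hq1 hx h1 h2 h3).2
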